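/- Let $T(n,m)$ ($n,m\ge 0$) be the array of integers with $T(n,0)=T(0,m)=1$ and, for $n,m\ge 1$, $$T(n,m)=T(n,m-1)+\sum_{k=0}^{\lfloor (n-1)/2\rfloor}T(2k,m-1)\,T(n-1-2k,m),$$ and let $T(n,x)=\sum_{m\ge 0}T(n,m)x^m$ be its $n$-th row generating function. For $n\ge 2$ put $H_n(x)=(1-x)^{n+1}T(n,x)$, and define the array $M_{i,j}$ ($i,j\ge 0$) by letting $M_{i,j}$ be the coefficient of $x^j$ in $H_{i+j+2}(x)$. For a finite pseudo graph $G$ (an undirected graph, loops allowed), a magic labelling of $G$ with magic sum $s$ is a labelling of the edges by nonnegative integers such that at each vertex the labels of the incident edges (each loop counted once) add up to $s$; let $\mathcal{M}(G,x)=\sum_{s\ge 0}M_G(s)x^s$, where $M_G(s)$ is the number of magic labellings of $G$ with magic sum $s$. Let $\tilde L_n$ be the path on $n+1$ vertices with one loop attached at each vertex. Then the following hold. 1. For every $n\ge 2$, $T(n,x)=H_n(x)/(1-x)^{n+1}$, where $H_n$ is a polynomial with integer coefficients of degree exactly $n-2$, namely $$H_n(x)=\sum_{j=0}^{n-2}M_{n-2-j,\,j}\,x^j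 .$$ The array begins (rows $i=0,\dots,5$, columns $j=0,\dots,5$) $$(M_{i,j})=\begin{pmatrix}1&1&1&1&1&1\\1&3&7&14&26&46\\1&7&31&109&334&937\\1&14&109&623&2951&12331\\1&26&334&2951&20641&123216\\1&46&937&12331&123216&1019051\end{pmatrix}.$$ 2. The array is symmetric: $M_{n,k}=M_{k,n}$ for all $n,k\ge 0$. 3. For every $n\ge 2$, $T(n,x)=\mathcal{M}(\tilde L_n,x)$ as power series, the series $\mathcal{M}(\tilde L_n,x)$ is the expansion at $0$ of a rational function, and this rational function satisfies $$x^3\,\mathcal{M}(\tilde L_n,x)=(-1)^{n+1}\,\mathcal{M}(\tilde L_n,1/x).$$ -/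

import Mathlib

open Finset

/-- The array `T(n, m)`: `T(n, 0) = T(0, m) = 1` and, for `n, m ≥ 1`,
`T(n, m) = T(n, m-1) + ∑_{k=0}^{⌊(n-1)/2⌋} T(2k, m-1) T(n-1-2k, m)`. (For `n = 0` the sum is empty
and the recursion gives `T(0, m) = T(0, m-1) = 1`.) In the last clause the first index is `n + 1`,
the second is `m + 1`, and `2 * k ≤ n` throughout the sum. -/
def zigzagT : ℕ → ℕ → ℕ
  | _, 0 => 1
  | 0, _ + 1 => 1
  | n + 1, m + 1 =>
      zigzagT (n + 1) m + ∑ k ∈ range (n / 2 + 1), zigzagT (2 * k) m * zigzagT (n - 2 * k) (m + 1)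
termination_by n m => (m, n)

/-- The defining recursion in its usual form. -/
theorem zigzagT_rec (n m : ℕ) (hn : 1 ≤ n) (hm : 1 ≤ m) :
    zigzagT n m = zigzagT n (m - 1) +
      ∑ k ∈ Icc 0 ((n - 1) / 2), zigzagT (2 * k) (m - 1) * zigzagT (n - 1 - 2 * k) m := by
  obtain ⟨n, rfl⟩ := Nat.exists_eq_add_of_le' hn
  obtain ⟨m, rfl⟩ := Nat.exists_eq_add_of_le' hm
  rw [zigzagT, Nat.range_succ_eq_Icc_zero]
  simp

/-- The row generating function `T(n, x) = ∑_{m ≥ 0} T(n, m) x^m`. -/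
noncomputable def rowSeries (n : ℕ) : PowerSeries ℤ :=
  PowerSeries.mk fun m => (zigzagT n m : ℤ)

/-- The array `M_{i,j}`, read off along its antidiagonals from the numerators of the row generating
functions: with `n = i + j + 2` (so `i = n - 2 - j`), `M_{i,j}` is the coefficient of `x^j` in
`H_n(x) = (1 - x)^{n+1} T(n, x)`. -/
noncomputable def arrayM (i j : ℕ) : ℤ :=
  PowerSeries.coeff j ((1 - PowerSeries.X) ^ (i + j + 3) * rowSeries (i + j + 2))

section MagicLabellings

variable {V : Type*} [DecidableEq V]

/-- A labelling `μ` of the edges of a pseudo graph (loops allowed) with edge set `E` is magic with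
magic sum `s` if at each vertex the labels of the incident edges add up to `s`; a loop counts
once at its vertex. -/
def IsMagicLabelling (E : Finset (Sym2 V)) (s : ℕ) (μ : E → ℕ) : Prop :=
  ∀ v : V, ∑ e : E, (if v ∈ (e : Sym2 V) then μ e else 0) = s

/-- The number of magic labellings with magic sum `s`. When there are finitely many vertices
this is the cardinality of a finite set, all labels being at most `s`. -/
noncomputable def magicCount (E : Finset (Sym2 V)) (s : ℕ) : ℕ :=
  Nat.card {μ : E → ℕ // IsMagicLabelling E s μ}

/-- The generating function `∑_{s ≥ 0} M_G(s) x^s` of magic labellings by magic sum. -/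
noncomputable def magicSeries (E : Finset (Sym2 V)) : PowerSeries ℤ :=
  PowerSeries.mk fun s => (magicCount E s : ℤ)

end MagicLabellings

open Classical in
/-- The edge set of the pseudo graph `L̃_n`: the path on `n + 1` vertices with one loop attached
at each vertex. -/
noncomputable def loopedPath (n : ℕ) : Finset (Sym2 (Fin (n + 1))) :=
  univ.filter fun e => e ∈ (SimpleGraph.pathGraph (n + 1)).edgeSet ∨ e.IsDiag

/-- `F` is the rational function with the given power series expansion at `0`. -/
def IsExpansionOf (f : PowerSeries ℤ) (F : RatFunc ℚ) : Prop :=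
  (F : LaurentSeries ℚ) = ((f.map (Int.castRingHom ℚ) : PowerSeries ℚ) : LaurentSeries ℚ)

/-- The rational function `F(1/x)`. As `1/x` is transcendental over `ℚ`, no denominator vanishes
there. -/
noncomputable def invertVar (F : RatFunc ℚ) : RatFunc ℚ :=
  F.eval RatFunc.C (RatFunc.X)⁻¹

/-- The top left `6 × 6` corner of the array `M`. -/
def tableM : Matrix (Fin 6) (Fin 6) ℤ :=
  !![1, 1, 1, 1, 1, 1;
     1, 3, 7, 14, 26, 46;
     1, 7, 31, 109, 334, 937;
     1, 14, 109, 623, 2951, 12331;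
     1, 26, 334, 2951, 20641, 123216;
     1, 46, 937, 12331, 123216, 1019051]

/-!
The argument runs through the column generating functions `G_s(z) = ∑ n, T(n, s) z ^ n`. Let `U_s`
be the Chebyshev polynomial `S_s` evaluated at `2 - z ^ 2`, for every integer `s`. Then
`G_s = (1 + z U_s) / (U_{s+1} - U_s)` for `s ≥ 0` (`coeff_colSeries_eq_zigzagT`): the denominator
`D_s = U_{s+1} - U_s` is even in `z`, so `1 / D_s` is the even part of `G_s`, and the recursion for
`T` becomes `G_s = G_{s-1} + z G_s / D_{s-1}` (`colSeries_rec`), which follows from the Cassini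
identity `U_s ^ 2 - U_{s-1} U_{s+1} = 1`.

The closed form makes sense for negative `s` as well, and three facts about it give the statements
on the array. The coefficient of `z ^ n` is a polynomial function of `s` of degree at most `n`
(`fwdDiff_iter_coeff_colSeries`, by the column recursion and the product rule for differences).
The reflection `U_{-s-2} = -U_s` yields `G_{-s-3}(z) = G_s(-z) - z` (`colSeries_reflect`).
Finally, `G_{-1} = 1`, so that for `n ≥ 2` the coefficients of `z ^ n` in `G_{-1}` and `G_{-2}`
vanish. Consequently `(1 - x) ^ (n + 1) T(n, x)` is a palindromic polynomial of degree `n - 2` with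
constant term `1` (`numCoeff_symm`), which is the symmetry of the array and the reciprocity of the
rational function at once.

A magic labelling of the looped path is a sequence of `n` labels of path edges in which neighbours
add up to at most `s`. Let such sequences begin next to an extra edge labelled `i`, and count them
by a series `F_i(z)` over `n`. These series satisfy `F_i = 1 + z ∑_{j ≤ s - i} F_j`, and the
explicit solution `F_i = (D_{i-1} + z U_{s-i}) / D_s` has `F_0 = G_s` (`card_pathFilling`,
`fillingSeries_zero`).
-/

/-! ### The closed form of the column series -/

/-- The Chebyshev polynomial `S_s` (with `S_{s+1}(t) = t S_s(t) - S_{s-1}(t)`, `S_{-1} = 0`,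
`S_0 = 1`) evaluated at `t = 2 - z ^ 2`, as a power series in `z`. -/
noncomputable def chebSeries (s : ℤ) : PowerSeries ℤ :=
  Polynomial.aeval (2 - PowerSeries.X ^ 2 : PowerSeries ℤ) (Polynomial.Chebyshev.S ℤ s)

/-- The difference of two consecutive `chebSeries`; it has constant term `1`. -/
noncomputable def chebDiff (s : ℤ) : PowerSeries ℤ := chebSeries (s + 1) - chebSeries s

/-- The reciprocal of `chebDiff s`; it is the even part of `colSeries s`. -/
noncomputable def evenColSeries (s : ℤ) : PowerSeries ℤ := PowerSeries.invOfUnit (chebDiff s) 1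

/-- The closed form of the column generating function `∑ n, T(n, s) z ^ n`, defined for every
integer `s`. -/
noncomputable def colSeries (s : ℤ) : PowerSeries ℤ :=
  (1 + PowerSeries.X * chebSeries s) * evenColSeries s

theorem chebSeries_add_one (s : ℤ) :
    chebSeries (s + 1) = (2 - PowerSeries.X ^ 2) * chebSeries s - chebSeries (s - 1) := by
  simp [chebSeries, Polynomial.Chebyshev.S_add_one]

theorem chebSeries_zero : chebSeries 0 = 1 := by simp [chebSeries]

theorem chebSeries_neg_one : chebSeries (-1) = 0 := by simp [chebSeries]

theorem chebSeries_reflect (s : ℤ) : chebSeries (-s - 2) = -chebSeries s := by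
  simp [chebSeries]

theorem constantCoeff_chebSeries (s : ℤ) :
    PowerSeries.constantCoeff (chebSeries s) = s + 1 := by
  rw [chebSeries, Polynomial.aeval_def, Polynomial.hom_eval₂]
  have : (PowerSeries.constantCoeff (R := ℤ)).comp (algebraMap ℤ (PowerSeries ℤ)) =
    RingHom.id ℤ := RingHom.ext_int _ _
  have h2 : PowerSeries.constantCoeff (2 : PowerSeries ℤ) = 2 := map_ofNat _ 2
  rw [this, Polynomial.eval₂_id]
  simp [h2]

theorem evalNegHom_chebSeries (s : ℤ) :
    PowerSeries.evalNegHom (chebSeries s) = chebSeries s := by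
  rw [chebSeries, Polynomial.aeval_def, Polynomial.hom_eval₂]
  congr 1
  · exact RingHom.ext_int _ _
  · have h2 : PowerSeries.evalNegHom (2 : PowerSeries ℤ) = 2 := map_ofNat _ 2
    simp [h2]

theorem chebSeries_cassini (s : ℤ) :
    chebSeries s ^ 2 - chebSeries (s - 1) * chebSeries (s + 1) = 1 := by
  have h := congrArg (Polynomial.aeval (2 - PowerSeries.X ^ 2 : PowerSeries ℤ))
    (Polynomial.Chebyshev.S_sq_add_S_sq ℤ s)
  simp only [map_sub, map_add, map_mul, map_pow, map_one, Polynomial.aeval_X] at h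
  have h' := chebSeries_add_one s
  change chebSeries s ^ 2 + chebSeries (s + 1) ^ 2 - _ * chebSeries s * chebSeries (s + 1) = 1 at h
  linear_combination h - chebSeries (s + 1) * h'

theorem chebDiff_sub_one (s : ℤ) : chebDiff (s - 1) = chebSeries s - chebSeries (s - 1) := by
  simp [chebDiff]

theorem chebDiff_sub_one_sub (s : ℤ) :
    chebDiff (s - 1) - chebDiff s = PowerSeries.X ^ 2 * chebSeries s := by
  rw [chebDiff_sub_one, chebDiff, chebSeries_add_one]
  ring

theorem chebDiff_mul_evenColSeries (s : ℤ) : chebDiff s * evenColSeries s = 1 :=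
  PowerSeries.mul_invOfUnit _ _ (by simp [chebDiff, constantCoeff_chebSeries])

theorem chebDiff_mul_colSeries (s : ℤ) :
    chebDiff s * colSeries s = 1 + PowerSeries.X * chebSeries s := by
  rw [colSeries]
  linear_combination (1 + PowerSeries.X * chebSeries s) * chebDiff_mul_evenColSeries s

/-- A series times `chebDiff s` determines the series. -/
theorem chebDiff_mul_left_cancel {s : ℤ} {f g : PowerSeries ℤ}
    (h : chebDiff s * f = chebDiff s * g) : f = g := by
  linear_combination evenColSeries s * h - (f - g) * chebDiff_mul_evenColSeries s

/-- The column recursion `G_s = G_{s-1} + z E_{s-1} G_s`, where `E` is the even part of `G`: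
this is the recursion defining `zigzagT`, collected over the first index. -/
theorem colSeries_rec (s : ℤ) :
    colSeries s = colSeries (s - 1) + PowerSeries.X * evenColSeries (s - 1) * colSeries s := by
  apply chebDiff_mul_left_cancel (s := s)
  apply chebDiff_mul_left_cancel (s := s - 1)
  have h1 := chebDiff_mul_colSeries s
  have h2 := chebDiff_mul_colSeries (s - 1)
  have h3 := chebDiff_mul_evenColSeries (s - 1)
  have h4 : chebSeries s * chebDiff (s - 1) - chebSeries (s - 1) * chebDiff s = 1 := by
    rw [chebDiff_sub_one, chebDiff]
    linear_combination chebSeries_cassini s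
  linear_combination (chebDiff (s - 1) - PowerSeries.X * chebDiff (s - 1) * evenColSeries (s - 1)) *
    h1 - chebDiff s * h2 - PowerSeries.X * (1 + PowerSeries.X * chebSeries s) * h3 +
    PowerSeries.X * h4 + chebDiff_sub_one_sub s

theorem evenColSeries_rec (s : ℤ) :
    evenColSeries (s + 1) = evenColSeries s +
      PowerSeries.X * (evenColSeries s * (colSeries (s + 1) - evenColSeries (s + 1))) := by
  have h := chebDiff_sub_one_sub (s + 1)
  rw [add_sub_cancel_right] at h
  rw [colSeries]
  linear_combination evenColSeries s * evenColSeries (s + 1) * h -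
    evenColSeries (s + 1) * chebDiff_mul_evenColSeries s +
    evenColSeries s * chebDiff_mul_evenColSeries (s + 1)

theorem evalNegHom_evenColSeries (s : ℤ) :
    PowerSeries.evalNegHom (evenColSeries s) = evenColSeries s := by
  apply chebDiff_mul_left_cancel (s := s)
  have h := congrArg PowerSeries.evalNegHom (chebDiff_mul_evenColSeries s)
  have hD : PowerSeries.evalNegHom (chebDiff s) = chebDiff s := by
    simp [chebDiff, evalNegHom_chebSeries]
  rw [map_mul, hD, map_one] at h
  rw [h, chebDiff_mul_evenColSeries]

theorem coeff_evalNegHom (f : PowerSeries ℤ) (n : ℕ) :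
    PowerSeries.coeff n (PowerSeries.evalNegHom f) = (-1) ^ n * PowerSeries.coeff n f :=
  PowerSeries.coeff_rescale _ _ _

theorem coeff_eq_zero_of_evalNegHom_eq_self {f : PowerSeries ℤ}
    (hf : PowerSeries.evalNegHom f = f) {n : ℕ} (hn : Odd n) : PowerSeries.coeff n f = 0 := by
  have h := coeff_evalNegHom f n
  rw [hf, hn.neg_one_pow] at h
  lia

theorem coeff_evenColSeries (s : ℤ) (n : ℕ) :
    PowerSeries.coeff n (evenColSeries s) =
      if Even n then PowerSeries.coeff n (colSeries s) else 0 := by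
  split_ifs with hn
  · have hE : PowerSeries.evalNegHom (chebSeries s * evenColSeries s) =
        chebSeries s * evenColSeries s := by
      rw [map_mul, evalNegHom_chebSeries, evalNegHom_evenColSeries]
    rw [colSeries, add_mul, one_mul, map_add, mul_assoc]
    rcases n with _ | n
    · simp
    · rw [PowerSeries.coeff_succ_X_mul, coeff_eq_zero_of_evalNegHom_eq_self hE, add_zero]
      simpa [Nat.even_add_one] using hn
  · exact coeff_eq_zero_of_evalNegHom_eq_self (evalNegHom_evenColSeries s)
      (Nat.not_even_iff_odd.mp hn)

theorem colSeries_neg_one : colSeries (-1) = 1 := by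
  have h := chebDiff_mul_colSeries (-1)
  simpa [chebDiff, chebSeries_neg_one, chebSeries_zero] using h

/-- Reciprocity: `G_{-s-3}(z) = G_s(-z) - z`. -/
theorem colSeries_reflect (s : ℤ) :
    colSeries (-s - 3) = PowerSeries.evalNegHom (colSeries s) - PowerSeries.X := by
  have h1 : chebSeries (-s - 3) = -chebSeries (s + 1) := by
    rw [← chebSeries_reflect]; congr 1; ring
  have h2 : chebSeries (-s - 3 + 1) = -chebSeries s := by
    rw [← chebSeries_reflect]; congr 1; ring
  have hD : chebDiff (-s - 3) = chebDiff s := by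
    rw [chebDiff, h1, h2, chebDiff]; ring
  apply chebDiff_mul_left_cancel (s := s)
  have h3 := chebDiff_mul_colSeries (-s - 3)
  have h4 := congrArg PowerSeries.evalNegHom (chebDiff_mul_colSeries s)
  rw [hD, h1] at h3
  simp only [map_mul, map_add, map_one, PowerSeries.evalNegHom_X, evalNegHom_chebSeries] at h4
  have h5 : PowerSeries.evalNegHom (chebDiff s) = chebDiff s := by
    simp [chebDiff, evalNegHom_chebSeries]
  rw [h5] at h4
  have h6 : chebDiff s = chebSeries (s + 1) - chebSeries s := rfl
  linear_combination h3 - h4 + PowerSeries.X * h6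

theorem coeff_colSeries_reflect (s : ℤ) {n : ℕ} (hn : 2 ≤ n) :
    PowerSeries.coeff n (colSeries (-s - 3)) = (-1) ^ n * PowerSeries.coeff n (colSeries s) := by
  rw [colSeries_reflect, map_sub, coeff_evalNegHom, PowerSeries.coeff_X, if_neg (by lia), sub_zero]

theorem coeff_colSeries_neg_one {n : ℕ} (hn : 2 ≤ n) :
    PowerSeries.coeff n (colSeries (-1)) = 0 := by
  rw [colSeries_neg_one, PowerSeries.coeff_one, if_neg (by lia)]

theorem coeff_colSeries_neg_two {n : ℕ} (hn : 2 ≤ n) :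
    PowerSeries.coeff n (colSeries (-2)) = 0 := by
  have h := coeff_colSeries_reflect (-1) hn
  rwa [coeff_colSeries_neg_one hn, mul_zero] at h

theorem coeff_zero_colSeries (s : ℤ) : PowerSeries.coeff 0 (colSeries s) = 1 := by
  simp [colSeries, evenColSeries]

theorem coeff_colSeries_zero (n : ℕ) : PowerSeries.coeff n (colSeries 0) = 1 := by
  have hrec := colSeries_rec 0
  have hE : evenColSeries (-1) = 1 := by
    simpa [chebDiff, chebSeries_neg_one, chebSeries_zero] using chebDiff_mul_evenColSeries (-1)
  rw [zero_sub, colSeries_neg_one, hE, mul_one] at hrec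
  induction n with
  | zero => exact coeff_zero_colSeries 0
  | succ n ih =>
    rw [hrec, map_add, PowerSeries.coeff_succ_X_mul, ih]
    simp [PowerSeries.coeff_one]

theorem coeff_colSeries_eq_zigzagT (n m : ℕ) :
    PowerSeries.coeff n (colSeries m) = zigzagT n m := by
  induction m generalizing n with
  | zero => simpa [zigzagT] using coeff_colSeries_zero n
  | succ m ihm =>
    induction n using Nat.strong_induction_on with
    | _ n ihn =>
    rcases n with _ | n
    · simp [zigzagT, coeff_zero_colSeries]
    · have hs : ((m + 1 : ℕ) : ℤ) - 1 = m := by simp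
      rw [colSeries_rec, hs, map_add, ihm, mul_assoc, PowerSeries.coeff_succ_X_mul,
        PowerSeries.coeff_mul, zigzagT, Nat.sum_antidiagonal_eq_sum_range_succ_mk]
      push_cast
      congr 1
      -- only even first indices contribute, and these are the `2 * k` with `k ≤ n / 2`
      simp only [coeff_evenColSeries, ite_mul, zero_mul]
      rw [← sum_filter]
      symm
      refine sum_bij (fun k _ => 2 * k) ?_ ?_ ?_ ?_
      · intro k hk
        simp only [mem_range, mem_filter] at hk ⊢
        exact ⟨by lia, by simp⟩
      · intro a _ b _ h
        lia
      · intro b hb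
        simp only [mem_range, mem_filter] at hb
        obtain ⟨hb, c, rfl⟩ := hb
        exact ⟨c, by rw [mem_range]; lia, by ring⟩
      · intro k hk
        simp only [mem_range] at hk
        rw [ihm, ← ihn _ (by lia)]
        push_cast
        rfl

/-! ### Polynomiality in the column index -/

/-- Product rule for vanishing iterated differences. -/
theorem fwdDiff_iter_mul_eq_zero {N a b : ℕ} {f g : ℤ → ℤ} (hab : a + b ≤ N + 1)
    (hf : (fwdDiff (1 : ℤ))^[a] f = 0) (hg : (fwdDiff (1 : ℤ))^[b] g = 0) :
    (fwdDiff (1 : ℤ))^[N] (fun s => f s * g s) = 0 := by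
  have hzero : ∀ M : ℕ, (fwdDiff (1 : ℤ))^[M] (fun _ => (0 : ℤ)) = 0 := fun M =>
    Function.iterate_fixed (fwdDiff_const 1 0) M
  induction N generalizing a b f g with
  | zero =>
    rcases a with _ | a
    · ext s; simp_all
    · obtain rfl : b = 0 := by lia
      ext s; simp_all
  | succ N ih =>
    rcases a with _ | a
    · obtain rfl : f = 0 := hf
      simpa using hzero (N + 1)
    rcases b with _ | b
    · obtain rfl : g = 0 := hg
      simpa using hzero (N + 1)
    have hshift : (fwdDiff (1 : ℤ))^[b + 1] (fun s => g (s + 1)) = 0 := by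
      ext s
      rw [fwdDiff_iter_comp_add, hg]
      rfl
    have hmul : fwdDiff (1 : ℤ) (fun s => f s * g s) =
        (fun s => fwdDiff 1 f s * g (s + 1)) + fun s => f s * fwdDiff 1 g s := by
      ext s
      simp only [fwdDiff, Pi.add_apply]
      ring
    rw [Function.iterate_succ_apply, hmul, fwdDiff_iter_add,
      ih (a := a) (b := b + 1) (by lia) hf hshift,
      ih (a := a + 1) (b := b) (by lia) hf hg, add_zero]

/-- The coefficients of `z ^ n` in `colSeries s` and `evenColSeries s` are polynomial functions of
`s` of degree at most `n`. -/
theorem fwdDiff_iter_coeff_colSeries (n : ℕ) :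
    (fwdDiff (1 : ℤ))^[n + 1] (fun s => PowerSeries.coeff n (colSeries s)) = 0 ∧
    (fwdDiff (1 : ℤ))^[n + 1] (fun s => PowerSeries.coeff n (evenColSeries s)) = 0 := by
  induction n using Nat.strong_induction_on with
  | _ n ih =>
  rcases n with _ | n
  · constructor <;> ext s <;> simp [coeff_evenColSeries, coeff_zero_colSeries]
  have hshift : ∀ (m : ℕ) (f : ℤ → ℤ), (fwdDiff (1 : ℤ))^[m] f = 0 →
      (fwdDiff (1 : ℤ))^[m] (fun s => f (s + 1)) = 0 := by
    intro m f hf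
    ext s
    rw [fwdDiff_iter_comp_add, hf]
    rfl
  have hG : fwdDiff (1 : ℤ) (fun s => PowerSeries.coeff (n + 1) (colSeries s)) =
      ∑ p ∈ antidiagonal n, fun s => PowerSeries.coeff p.1 (evenColSeries s) *
        PowerSeries.coeff p.2 (colSeries (s + 1)) := by
    ext s
    have h := colSeries_rec (s + 1)
    rw [add_sub_cancel_right, mul_assoc] at h
    have h' := congrArg (PowerSeries.coeff (n + 1)) h
    rw [map_add, PowerSeries.coeff_succ_X_mul, PowerSeries.coeff_mul] at h'
    simp only [fwdDiff, Finset.sum_apply]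
    rw [h', add_sub_cancel_left]
  have hE : fwdDiff (1 : ℤ) (fun s => PowerSeries.coeff (n + 1) (evenColSeries s)) =
      ∑ p ∈ antidiagonal n, fun s => PowerSeries.coeff p.1 (evenColSeries s) *
        (PowerSeries.coeff p.2 (colSeries (s + 1)) -
          PowerSeries.coeff p.2 (evenColSeries (s + 1))) := by
    ext s
    have h' := congrArg (PowerSeries.coeff (n + 1)) (evenColSeries_rec s)
    rw [map_add, PowerSeries.coeff_succ_X_mul, PowerSeries.coeff_mul] at h'
    simp only [fwdDiff, Finset.sum_apply]
    rw [h', add_sub_cancel_left]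
    simp only [map_sub]
  rw [Function.iterate_succ_apply, hG, fwdDiff_iter_finsetSum, Function.iterate_succ_apply, hE,
    fwdDiff_iter_finsetSum]
  constructor <;> refine sum_eq_zero fun p hp => ?_ <;> rw [HasAntidiagonal.mem_antidiagonal] at hp
  · exact fwdDiff_iter_mul_eq_zero (a := p.1 + 1) (b := p.2 + 1) (by lia) (ih _ (by lia)).2
      (hshift _ _ (ih _ (by lia)).1)
  · refine fwdDiff_iter_mul_eq_zero (a := p.1 + 1) (b := p.2 + 1) (by lia) (ih _ (by lia)).2 ?_
    have hsub : (fun s => PowerSeries.coeff p.2 (colSeries (s + 1)) -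
        PowerSeries.coeff p.2 (evenColSeries (s + 1))) =
        (fun s => PowerSeries.coeff p.2 (colSeries (s + 1))) +
          (-1 : ℤ) • fun s => PowerSeries.coeff p.2 (evenColSeries (s + 1)) := by
      ext s; simp [sub_eq_add_neg]
    rw [hsub, fwdDiff_iter_add, fwdDiff_iter_const_smul,
      hshift _ (fun s => PowerSeries.coeff p.2 (colSeries s)) (ih _ (by lia)).1,
      hshift _ (fun s => PowerSeries.coeff p.2 (evenColSeries s)) (ih _ (by lia)).2]
    simp

theorem sum_choose_mul_coeff_colSeries (n : ℕ) (j : ℤ) :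
    ∑ k ∈ range (n + 2), (-1) ^ k * ((n + 1).choose k : ℤ) *
      PowerSeries.coeff n (colSeries (j - k)) = 0 := by
  have h := congrFun (fwdDiff_iter_coeff_colSeries n).1 (j - (n + 1 : ℕ))
  rw [fwdDiff_iter_eq_sum_shift] at h
  rw [← sum_range_reflect, ← Pi.zero_apply (M := fun _ => ℤ) (j - (n + 1 : ℕ)), ← h]
  refine sum_congr rfl fun k hk => ?_
  have hk' : k ≤ n + 1 := Nat.lt_succ_iff.mp (mem_range.mp hk)
  have e : n + 2 - 1 - k = n + 1 - k := by lia
  rw [e, Nat.choose_symm hk', smul_eq_mul]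
  congr 3
  push_cast [Nat.cast_sub hk']
  simp only [nsmul_eq_mul, mul_one]
  ring

/-! ### The numerators -/

/-- The coefficient of `x ^ s` in the row series `T(n, x)`, extended by `0` to negative `s`. -/
noncomputable def rowCoeff (n : ℕ) (s : ℤ) : ℤ :=
  if 0 ≤ s then PowerSeries.coeff n (colSeries s) else 0

/-- The coefficient of `x ^ j` in `(1 - x) ^ (n + 1) T(n, x)`, for an arbitrary integer `j`. -/
noncomputable def numCoeff (n : ℕ) (j : ℤ) : ℤ :=
  ∑ k ∈ range (n + 2), (-1) ^ k * ((n + 1).choose k : ℤ) * rowCoeff n (j - k)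

theorem rowCoeff_natCast (n m : ℕ) : rowCoeff n m = zigzagT n m := by
  simp [rowCoeff, coeff_colSeries_eq_zigzagT]

theorem numCoeff_of_neg (n : ℕ) {j : ℤ} (hj : j < 0) : numCoeff n j = 0 := by
  refine sum_eq_zero fun k _ => ?_
  rw [rowCoeff, if_neg (by lia), mul_zero]

theorem numCoeff_zero (n : ℕ) : numCoeff n 0 = 1 := by
  rw [numCoeff, sum_range_succ', sum_eq_zero]
  · simp [rowCoeff, coeff_colSeries_zero]
  · intro k _
    rw [rowCoeff, if_neg (by push_cast; lia), mul_zero]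

/-- The values at negative arguments, which the row series leaves out, are those of the row series
itself, reflected. The zeros at `-1` and `-2` make the reflection shift by `3`. -/
theorem coeff_colSeries_eq_rowCoeff {n : ℕ} (hn : 2 ≤ n) (s : ℤ) :
    PowerSeries.coeff n (colSeries s) = rowCoeff n s + (-1) ^ n * rowCoeff n (-s - 3) := by
  rcases le_or_gt 0 s with h | h
  · rw [rowCoeff, if_pos h, rowCoeff, if_neg (by lia), mul_zero, add_zero]
  rcases le_or_gt 0 (-s - 3) with h' | h'
  · rw [rowCoeff, if_neg (by lia), rowCoeff, if_pos h', ← coeff_colSeries_reflect _ hn, zero_add]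
    congr 2
    ring
  · obtain rfl | rfl : s = -1 ∨ s = -2 := by lia
    · simp [rowCoeff, coeff_colSeries_neg_one hn]
    · simp [rowCoeff, coeff_colSeries_neg_two hn]

/-- The numerator is palindromic. -/
theorem numCoeff_symm {n : ℕ} (hn : 2 ≤ n) (j : ℤ) : numCoeff n (n - 2 - j) = numCoeff n j := by
  have h := sum_choose_mul_coeff_colSeries n j
  simp only [coeff_colSeries_eq_rowCoeff hn, mul_add, sum_add_distrib] at h
  change numCoeff n j + _ = 0 at h
  rw [← sum_range_reflect] at h
  rw [eq_neg_of_add_eq_zero_left h, numCoeff, ← sum_neg_distrib]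
  refine sum_congr rfl fun k hk => ?_
  have hk' : k ≤ n + 1 := Nat.lt_succ_iff.mp (mem_range.mp hk)
  have e : n + 2 - 1 - k = n + 1 - k := by lia
  have e2 : -(j - ((n + 1 - k : ℕ) : ℤ)) - 3 = n - 2 - j - k := by
    push_cast [Nat.cast_sub hk']
    ring
  have e3 : (-1 : ℤ) ^ (n + 1 - k) * (-1) ^ n = -(-1) ^ k := by
    obtain ⟨l, hl⟩ := Nat.exists_eq_add_of_le hk'
    have h1 : n + 1 - k = l := by lia
    have h2 : (-1 : ℤ) ^ n = -((-1) ^ k * (-1) ^ l) := by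
      rw [← pow_add, ← hl, pow_succ]; ring
    have h3 : ((-1 : ℤ) ^ l) * (-1) ^ l = 1 := by
      rw [← mul_pow]; simp
    rw [h1, h2]
    linear_combination -(-1 : ℤ) ^ k * h3
  rw [e, Nat.choose_symm hk', e2]
  linear_combination ((n + 1).choose k : ℤ) * rowCoeff n (n - 2 - j - k) * e3

theorem coeff_one_sub_X_pow (N k : ℕ) :
    PowerSeries.coeff k ((1 - PowerSeries.X : PowerSeries ℤ) ^ N) = (-1) ^ k * (N.choose k : ℤ) := by
  have h : (1 - PowerSeries.X : PowerSeries ℤ) ^ N =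
      PowerSeries.evalNegHom (((1 + Polynomial.X : Polynomial ℤ) ^ N : Polynomial ℤ)) := by
    simp [sub_eq_add_neg]
  rw [h, coeff_evalNegHom, Polynomial.coeff_coe, Polynomial.coeff_one_add_X_pow]

theorem coeff_one_sub_X_pow_mul_rowSeries (n j : ℕ) :
    PowerSeries.coeff j ((1 - PowerSeries.X) ^ (n + 1) * rowSeries n) = numCoeff n j := by
  rw [PowerSeries.coeff_mul, Nat.sum_antidiagonal_eq_sum_range_succ_mk, numCoeff]
  simp only [coeff_one_sub_X_pow]
  -- both sums may be extended to the range `k < j + n + 2`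
  trans ∑ k ∈ range (j + n + 2), (-1) ^ k * ((n + 1).choose k : ℤ) * rowCoeff n (j - k)
  · rw [← sum_subset (range_mono (by lia : j.succ ≤ j + n + 2))]
    · refine sum_congr rfl fun k hk => ?_
      rw [← Nat.cast_sub (Nat.lt_succ_iff.mp (mem_range.mp hk)), rowCoeff_natCast, rowSeries,
        PowerSeries.coeff_mk]
    · intro k _ hk
      rw [mem_range] at hk
      rw [rowCoeff, if_neg (by lia), mul_zero]
  · refine (sum_subset (range_mono (by lia)) fun k _ hk => ?_).symm
    rw [mem_range] at hk
    rw [Nat.choose_eq_zero_of_lt (by lia)]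
    simp

theorem arrayM_eq_numCoeff (i j : ℕ) : arrayM i j = numCoeff (i + j + 2) j :=
  coeff_one_sub_X_pow_mul_rowSeries _ _

theorem arrayM_symm (i j : ℕ) : arrayM i j = arrayM j i := by
  rw [arrayM_eq_numCoeff, arrayM_eq_numCoeff, ← numCoeff_symm (by lia), add_comm j i]
  congr 1
  push_cast
  ring

/-- The numerator `H_n` of the row series `T(n, x) = H_n(x) / (1 - x) ^ (n + 1)`. -/
noncomputable def numPoly (n : ℕ) : Polynomial ℤ :=
  ∑ j ∈ range (n - 1), Polynomial.C (arrayM (n - 2 - j) j) * Polynomial.X ^ j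

theorem coeff_numPoly {n : ℕ} (hn : 2 ≤ n) (j : ℕ) : (numPoly n).coeff j = numCoeff n j := by
  simp only [numPoly, Polynomial.finsetSum_coeff, Polynomial.coeff_C_mul_X_pow]
  rw [sum_ite_eq]
  split_ifs with h
  · rw [mem_range] at h
    rw [arrayM_eq_numCoeff, show n - 2 - j + j + 2 = n by lia]
  · rw [mem_range] at h
    rw [← numCoeff_symm hn, numCoeff_of_neg]
    lia

theorem one_sub_X_pow_mul_rowSeries {n : ℕ} (hn : 2 ≤ n) :
    (1 - PowerSeries.X) ^ (n + 1) * rowSeries n = (numPoly n : PowerSeries ℤ) := by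
  ext j
  rw [coeff_one_sub_X_pow_mul_rowSeries, Polynomial.coeff_coe, coeff_numPoly hn]

theorem natDegree_numPoly_le {n : ℕ} (hn : 2 ≤ n) : (numPoly n).natDegree ≤ n - 2 := by
  rw [Polynomial.natDegree_le_iff_coeff_eq_zero]
  intro j hj
  rw [coeff_numPoly hn, ← numCoeff_symm hn, numCoeff_of_neg]
  lia

theorem degree_numPoly {n : ℕ} (hn : 2 ≤ n) :
    (numPoly n).degree = ((n - 2 : ℕ) : WithBot ℕ) := by
  refine le_antisymm (Polynomial.degree_le_of_natDegree_le (natDegree_numPoly_le hn))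
    (Polynomial.le_degree_of_ne_zero ?_)
  rw [coeff_numPoly hn, ← numCoeff_symm hn, show (n : ℤ) - 2 - (n - 2 : ℕ) = 0 by lia,
    numCoeff_zero]
  exact one_ne_zero

theorem reflect_numPoly {n : ℕ} (hn : 2 ≤ n) : (numPoly n).reflect (n - 2) = numPoly n := by
  ext j
  rw [Polynomial.coeff_reflect]
  rcases le_or_gt j (n - 2) with h | h
  · rw [Polynomial.revAt_le h, coeff_numPoly hn, coeff_numPoly hn, ← numCoeff_symm hn]
    congr 1
    lia
  · rw [Polynomial.revAt_eq_self_of_lt h]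

theorem arrayM_eq_sum (i j : ℕ) :
    arrayM i j = ∑ k ∈ range (j + 1),
      (-1) ^ k * ((i + j + 3).choose k : ℤ) * zigzagT (i + j + 2) (j - k) := by
  rw [arrayM, PowerSeries.coeff_mul, Nat.sum_antidiagonal_eq_sum_range_succ_mk]
  simp only [coeff_one_sub_X_pow, rowSeries, PowerSeries.coeff_mk]

set_option maxRecDepth 10000 in
set_option maxHeartbeats 2000000 in
theorem arrayM_eq_tableM (i j : Fin 6) : arrayM i j = tableM i j := by
  wlog h : j ≤ i
  · have hT : ∀ i j, tableM j i = tableM i j := fun i j => by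
      fin_cases i <;> fin_cases j <;> rfl
    rw [arrayM_symm, this j i (le_of_not_ge h), hT]
  fin_cases i <;> fin_cases j <;> first
    | exact absurd h (by decide)
    | simp [arrayM_eq_sum, tableM, sum_range_succ, zigzagT, Nat.choose]

/-! ### Counting magic labellings of the looped path -/

/-- Fillings `a` of the path edges of a looped path whose loops still admit nonnegative labels
completing every vertex sum to `s`. An extra edge labelled `i` is attached at the initial vertex;
the `v`-th vertex is met by the entry `v` of `Fin.cons i a` and the entry `v` of `Fin.snoc a 0`. -/
abbrev PathFilling (s n i : ℕ) : Type :=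
  {a : Fin n → ℕ // ∀ v : Fin (n + 1),
    (Fin.cons i a : Fin (n + 1) → ℕ) v + (Fin.snoc a 0 : Fin (n + 1) → ℕ) v ≤ s}

/-- Splitting off the label of the first path edge. -/
def pathFillingSuccEquiv (s n i : ℕ) :
    PathFilling s (n + 1) i ≃ Σ j : {j : ℕ // i + j ≤ s}, PathFilling s n j where
  toFun a := ⟨⟨a.1 0, by simpa [Fin.snoc] using a.2 0⟩, Fin.tail a.1, fun v => by
    have h := a.2 v.succ
    rw [← Fin.cons_self_tail a.1] at h
    rw [← Fin.cons_snoc_eq_snoc_cons] at h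
    simpa using h⟩
  invFun p := ⟨Fin.cons p.1.1 p.2.1, by
    intro v
    rw [← Fin.cons_snoc_eq_snoc_cons]
    refine Fin.cases ?_ (fun v => ?_) v
    · simpa using p.1.2
    · simpa using p.2.2 v⟩
  left_inv a := by simp
  right_inv _ := rfl

theorem finite_pathFilling (s n i : ℕ) : Finite (PathFilling s n i) := by
  induction n generalizing i with
  | zero => infer_instance
  | succ n ih =>
    have : Finite {j : ℕ // i + j ≤ s} :=
      Set.Finite.to_subtype ((Set.finite_Iic s).subset fun j hj =>
        (Nat.le_add_left j i).trans hj)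
    exact Finite.of_equiv _ (pathFillingSuccEquiv s n i).symm

theorem card_pathFilling_zero {s i : ℕ} (h : i ≤ s) : Nat.card (PathFilling s 0 i) = 1 := by
  rw [Nat.card_eq_one_iff_unique]
  refine ⟨inferInstance, ⟨⟨Fin.elim0, fun v => ?_⟩⟩⟩
  rw [show v = 0 from Fin.fin_one_eq_zero v]
  simpa [Fin.snoc] using h

theorem card_pathFilling_succ {s i : ℕ} (n : ℕ) (h : i ≤ s) :
    Nat.card (PathFilling s (n + 1) i) =
      ∑ j ∈ range (s - i + 1), Nat.card (PathFilling s n j) := by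
  have := fun j : {j : ℕ // i + j ≤ s} => finite_pathFilling s n j
  have e : ∀ j, j ∈ range (s - i + 1) ↔ i + j ≤ s := fun j => by rw [mem_range]; lia
  let : Fintype {j : ℕ // i + j ≤ s} := Fintype.subtype (range (s - i + 1)) e
  rw [Nat.card_congr (pathFillingSuccEquiv s n i), Nat.card_sigma]
  exact (sum_subtype (range (s - i + 1)) e fun j => Nat.card (PathFilling s n j)).symm

/-- The generating function of `Nat.card (PathFilling s n i)` over `n`, in closed form. -/
noncomputable def fillingSeries (s i : ℤ) : PowerSeries ℤ :=
  (chebDiff (i - 1) + PowerSeries.X * chebSeries (s - i)) * evenColSeries s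

theorem fillingSeries_sub (s i : ℤ) :
    fillingSeries s i - fillingSeries s (i + 1) = PowerSeries.X * fillingSeries s (s - i) := by
  have h1 := chebDiff_sub_one_sub i
  have h2 := chebDiff_sub_one (s - i)
  have e1 : s - (i + 1) = s - i - 1 := by ring
  have e2 : s - (s - i) = i := by ring
  simp only [fillingSeries, add_sub_cancel_right, e1, e2]
  linear_combination evenColSeries s * h1 - PowerSeries.X * evenColSeries s * h2

theorem fillingSeries_self_add_one (s : ℤ) : fillingSeries s (s + 1) = 1 := by
  have e : s - (s + 1) = -1 := by ring
  rw [fillingSeries, e, chebSeries_neg_one, add_sub_cancel_right, mul_zero, add_zero,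
    chebDiff_mul_evenColSeries]

theorem fillingSeries_zero (s : ℤ) : fillingSeries s 0 = colSeries s := by
  rw [fillingSeries, chebDiff_sub_one, zero_sub, chebSeries_neg_one, chebSeries_zero, sub_zero,
    sub_zero, colSeries]

/-- The telescoped form of `fillingSeries_sub`. -/
theorem fillingSeries_eq_one_add (s k : ℕ) :
    fillingSeries s ((s : ℤ) + 1 - k) =
      1 + PowerSeries.X * ∑ j ∈ range k, fillingSeries s j := by
  induction k with
  | zero => simpa using fillingSeries_self_add_one s
  | succ k ih =>
    have h := fillingSeries_sub s (s - k)
    have e1 : (s : ℤ) - k + 1 = s + 1 - k := by ring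
    have e2 : (s : ℤ) - (s - k) = k := by ring
    have e3 : (s : ℤ) + 1 - (k + 1 : ℕ) = s - k := by push_cast; ring
    rw [e1, e2] at h
    rw [e3, sum_range_succ]
    linear_combination h + ih

theorem card_pathFilling (s n i : ℕ) (h : i ≤ s) :
    (Nat.card (PathFilling s n i) : ℤ) = PowerSeries.coeff n (fillingSeries s i) := by
  have hs : fillingSeries s i =
      1 + PowerSeries.X * ∑ j ∈ range (s - i + 1), fillingSeries s j := by
    rw [← fillingSeries_eq_one_add]
    congr 1
    lia
  induction n generalizing i with
  | zero => rw [card_pathFilling_zero h, hs]; simp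
  | succ n ih =>
    rw [card_pathFilling_succ n h, hs, map_add, PowerSeries.coeff_succ_X_mul, map_sum,
      PowerSeries.coeff_one, if_neg (by lia), zero_add]
    push_cast
    refine sum_congr rfl fun j hj => ?_
    rw [mem_range] at hj
    refine ih j (by lia) ?_
    rw [← fillingSeries_eq_one_add]
    congr 1
    lia

/-- The path edges, then the loops, of the looped path. -/
def loopedPathEdge (n : ℕ) : Fin n ⊕ Fin (n + 1) → Sym2 (Fin (n + 1)) :=
  Sum.elim (fun k => s(k.castSucc, k.succ)) fun v => s(v, v)

theorem loopedPathEdge_mem {n : ℕ} (x : Fin n ⊕ Fin (n + 1)) :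
    loopedPathEdge n x ∈ loopedPath n := by
  rcases x with k | v
  · simp [loopedPathEdge, loopedPath, SimpleGraph.pathGraph_adj]
  · simp [loopedPathEdge, loopedPath]

theorem exists_loopedPathEdge_eq {n : ℕ} {e : Sym2 (Fin (n + 1))} (he : e ∈ loopedPath n) :
    ∃ x, loopedPathEdge n x = e := by
  simp only [loopedPath, mem_filter, mem_univ, true_and] at he
  rcases he with he | he
  · induction e with
    | _ u v =>
    rw [SimpleGraph.mem_edgeSet, SimpleGraph.pathGraph_adj] at he
    rcases he with he | he
    · refine ⟨Sum.inl ⟨u, by lia⟩, ?_⟩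
      have : (⟨u, by lia⟩ : Fin n).succ = v := Fin.ext he
      simp [loopedPathEdge, this]
    · refine ⟨Sum.inl ⟨v, by lia⟩, ?_⟩
      have : (⟨v, by lia⟩ : Fin n).succ = u := Fin.ext he
      simp [loopedPathEdge, this, Sym2.eq_swap]
  · induction e with
    | _ u v =>
    obtain rfl : u = v := he
    exact ⟨Sum.inr u, rfl⟩

theorem loopedPathEdge_injective (n : ℕ) : Function.Injective (loopedPathEdge n) := by
  rintro (k | v) (l | w) h <;>
    simp only [loopedPathEdge, Sum.elim_inl, Sum.elim_inr, Sym2.eq_iff, Fin.ext_iff,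
      Fin.val_castSucc, Fin.val_succ] at h <;>
    simp only [Sum.inl.injEq, Sum.inr.injEq, Fin.ext_iff, reduceCtorEq] <;> lia

/-- The edges of the looped path: path edges and loops. -/
noncomputable def loopedPathEquiv (n : ℕ) : Fin n ⊕ Fin (n + 1) ≃ loopedPath n :=
  Equiv.ofBijective (fun x => ⟨loopedPathEdge n x, loopedPathEdge_mem x⟩)
    ⟨fun _ _ h => loopedPathEdge_injective n (congrArg Subtype.val h),
      fun e => (exists_loopedPathEdge_eq e.2).imp fun _ h => Subtype.ext h⟩

theorem sum_ite_eq_castSucc {n : ℕ} (a : Fin n → ℕ) (v : Fin (n + 1)) :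
    ∑ k, (if v = k.castSucc then a k else 0) = (Fin.snoc a 0 : Fin (n + 1) → ℕ) v := by
  refine Fin.lastCases ?_ (fun v => ?_) v
  · simp [(Fin.castSucc_ne_last _).symm]
  · simp

theorem sum_ite_eq_succ {n : ℕ} (a : Fin n → ℕ) (v : Fin (n + 1)) :
    ∑ k, (if v = k.succ then a k else 0) = (Fin.cons 0 a : Fin (n + 1) → ℕ) v := by
  refine Fin.cases ?_ (fun v => ?_) v
  · simp [(Fin.succ_ne_zero _).symm]
  · simp

theorem sum_loopedPath (n : ℕ) (μ : loopedPath n → ℕ) (v : Fin (n + 1)) :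
    ∑ e : loopedPath n, (if v ∈ (e : Sym2 (Fin (n + 1))) then μ e else 0) =
      (Fin.cons 0 (fun k => μ (loopedPathEquiv n (Sum.inl k))) : Fin (n + 1) → ℕ) v +
      (Fin.snoc (fun k => μ (loopedPathEquiv n (Sum.inl k))) 0 : Fin (n + 1) → ℕ) v +
      μ (loopedPathEquiv n (Sum.inr v)) := by
  rw [← (loopedPathEquiv n).sum_comp, Fintype.sum_sum_type, ← sum_ite_eq_castSucc,
    ← sum_ite_eq_succ, ← sum_add_distrib]
  congr 1
  · refine sum_congr rfl fun k _ => ?_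
    have hk : k.castSucc ≠ k.succ := Fin.castSucc_lt_succ.ne
    change (if v ∈ s(k.castSucc, k.succ) then _ else 0) = _
    simp only [Sym2.mem_iff]
    split_ifs <;> simp_all
  · change ∑ w, (if v ∈ s(w, w) then _ else 0) = _
    simp

/-- A magic labelling is determined by its restriction to the path edges, since the label of a
loop is what its vertex lacks of the magic sum. -/
noncomputable def magicLabellingEquiv (s n : ℕ) :
    {μ : loopedPath n → ℕ // IsMagicLabelling (loopedPath n) s μ} ≃ PathFilling s n 0 where
  toFun μ := ⟨fun k => μ.1 (loopedPathEquiv n (Sum.inl k)), fun v => by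
    have h := μ.2 v
    rw [sum_loopedPath] at h
    lia⟩
  invFun a := ⟨fun e => Sum.elim a.1 (fun v => s - ((Fin.cons 0 a.1 : Fin (n + 1) → ℕ) v +
      (Fin.snoc a.1 0 : Fin (n + 1) → ℕ) v)) ((loopedPathEquiv n).symm e), fun v => by
    rw [sum_loopedPath]
    simp only [Equiv.symm_apply_apply, Sum.elim_inl, Sum.elim_inr]
    have h := a.2 v
    lia⟩
  left_inv μ := by
    ext e
    obtain ⟨x, rfl⟩ := (loopedPathEquiv n).surjective e
    rcases x with k | v
    · simp
    · have h := μ.2 v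
      rw [sum_loopedPath] at h
      simp only [Equiv.symm_apply_apply, Sum.elim_inr]
      lia
  right_inv a := by
    ext k
    simp

theorem magicCount_loopedPath (n s : ℕ) : magicCount (loopedPath n) s = zigzagT n s := by
  have h := card_pathFilling s n 0 (Nat.zero_le s)
  rw [Nat.cast_zero, fillingSeries_zero, coeff_colSeries_eq_zigzagT] at h
  rw [magicCount, Nat.card_congr (magicLabellingEquiv s n)]
  exact_mod_cast h

theorem rowSeries_eq_magicSeries (n : ℕ) : rowSeries n = magicSeries (loopedPath n) := by
  ext s
  rw [rowSeries, magicSeries, PowerSeries.coeff_mk, PowerSeries.coeff_mk, magicCount_loopedPath]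

/-! ### Rational functions -/

theorem one_sub_X_ne_zero : (1 - RatFunc.X : RatFunc ℚ) ≠ 0 := by
  rw [sub_ne_zero, ← RatFunc.algebraMap_X, ← map_one (algebraMap (Polynomial ℚ) (RatFunc ℚ))]
  intro h
  simpa using congrArg (Polynomial.eval 0) (RatFunc.algebraMap_injective ℚ h)

theorem invertVar_div {p q : Polynomial ℚ}
    (hq : q.eval₂ RatFunc.C (RatFunc.X)⁻¹ ≠ (0 : RatFunc ℚ)) :
    invertVar (algebraMap _ (RatFunc ℚ) p / algebraMap _ (RatFunc ℚ) q) =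
      p.eval₂ RatFunc.C (RatFunc.X)⁻¹ / q.eval₂ RatFunc.C (RatFunc.X)⁻¹ := by
  have hq0 : q ≠ 0 := by
    rintro rfl
    simp at hq
  have hd := Polynomial.eval₂_dvd (RatFunc.C (K := ℚ)) (RatFunc.X)⁻¹ (RatFunc.denom_div_dvd p q)
  have h := congrArg (Polynomial.eval₂ (RatFunc.C (K := ℚ)) (RatFunc.X)⁻¹)
    ((RatFunc.num_mul_eq_mul_denom_iff hq0).mpr
      (rfl : algebraMap _ (RatFunc ℚ) p / algebraMap _ (RatFunc ℚ) q = _))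
  rw [Polynomial.eval₂_mul, Polynomial.eval₂_mul] at h
  rw [invertVar, RatFunc.eval, div_eq_div_iff (ne_zero_of_dvd_ne_zero hq hd) hq, h]

theorem eval₂_inv_X_mul_pow {p : Polynomial ℚ} {N : ℕ} (hp : p.natDegree ≤ N) :
    (p.reflect N).eval₂ RatFunc.C (RatFunc.X)⁻¹ * RatFunc.X ^ N = algebraMap _ (RatFunc ℚ) p := by
  let : Invertible (RatFunc.X : RatFunc ℚ) := invertibleOfNonzero RatFunc.X_ne_zero
  have h := Polynomial.eval₂_reflect_mul_pow (RatFunc.C (K := ℚ)) RatFunc.X N p hp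
  rw [invOf_eq_inv] at h
  rw [h, ← RatFunc.aeval_X_left_eq_algebraMap]
  rfl

theorem coe_div_eq_of_mul_eq {F : Type*} [Field F] {p q : Polynomial F} {f : PowerSeries F}
    (hq : q ≠ 0) (h : (q : PowerSeries F) * f = p) :
    ((algebraMap _ (RatFunc F) p / algebraMap _ (RatFunc F) q : RatFunc F) : LaurentSeries F) =
      (f : LaurentSeries F) := by
  have hq' : algebraMap _ (RatFunc F) q ≠ 0 := RatFunc.algebraMap_ne_zero hq
  have hc : ∀ r : Polynomial F, ((algebraMap _ (RatFunc F) r : RatFunc F) : LaurentSeries F) =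
      ((r : PowerSeries F) : LaurentSeries F) := fun r =>
    (RatFunc.coe_coe r).symm
  rw [map_div₀, div_eq_iff ((map_ne_zero _).mpr hq'), hc, hc, ← h, PowerSeries.coe_mul, mul_comm]

/-- The row series as a rational function. -/
noncomputable def rowRatFunc (n : ℕ) : RatFunc ℚ :=
  algebraMap _ (RatFunc ℚ) ((numPoly n).map (Int.castRingHom ℚ)) /
    algebraMap _ (RatFunc ℚ) ((1 - Polynomial.X : Polynomial ℚ) ^ (n + 1))

theorem isExpansionOf_rowRatFunc {n : ℕ} (hn : 2 ≤ n) :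
    IsExpansionOf (rowSeries n) (rowRatFunc n) := by
  have hq : (1 - Polynomial.X : Polynomial ℚ) ^ (n + 1) ≠ 0 := by
    refine pow_ne_zero _ fun h => ?_
    simpa using congrArg (Polynomial.eval 0) h
  refine coe_div_eq_of_mul_eq hq ?_
  rw [Polynomial.polynomial_map_coe, ← one_sub_X_pow_mul_rowSeries hn]
  simp

/-- The palindromic numerator gives the self-reciprocity of the rational function. -/
theorem rowRatFunc_reciprocity {n : ℕ} (hn : 2 ≤ n) :
    RatFunc.X ^ 3 * rowRatFunc n = (-1) ^ (n + 1) * invertVar (rowRatFunc n) := by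
  obtain ⟨m, rfl⟩ := Nat.exists_eq_add_of_le' hn
  have hX : (RatFunc.X : RatFunc ℚ) ≠ 0 := RatFunc.X_ne_zero
  have hX1 := one_sub_X_ne_zero
  have hinv : (1 - (RatFunc.X)⁻¹ : RatFunc ℚ) = -1 * (1 - RatFunc.X) / RatFunc.X := by
    field_simp
    ring
  have hq : ((1 - Polynomial.X : Polynomial ℚ) ^ (m + 2 + 1)).eval₂ RatFunc.C (RatFunc.X)⁻¹ =
      (-1) ^ (m + 3) * (1 - RatFunc.X : RatFunc ℚ) ^ (m + 3) / RatFunc.X ^ (m + 3) := by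
    rw [← mul_pow, ← div_pow, ← hinv, Polynomial.eval₂_pow, Polynomial.eval₂_sub,
      Polynomial.eval₂_one, Polynomial.eval₂_X]
  have hp := eval₂_inv_X_mul_pow (p := (numPoly (m + 2)).map (Int.castRingHom ℚ)) (N := m)
    (Polynomial.natDegree_map_le.trans (natDegree_numPoly_le hn))
  have hr := reflect_numPoly hn
  rw [Nat.add_sub_cancel] at hr
  rw [Polynomial.reflect_map, hr] at hp
  rw [rowRatFunc, invertVar_div, hq, ← hp]
  · simp only [map_pow, map_sub, map_one, RatFunc.algebraMap_X]
    have hs : ((-1 : RatFunc ℚ) ^ (m + 3)) ≠ 0 := pow_ne_zero _ (by simp)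
    field_simp
    ring
  · rw [hq]
    exact div_ne_zero (mul_ne_zero (pow_ne_zero _ (by simp)) (pow_ne_zero _ hX1))
      (pow_ne_zero _ hX)

theorem mainTheorem8 :
    (∀ n : ℕ, 2 ≤ n → ∃ H : Polynomial ℤ,
      (1 - PowerSeries.X) ^ (n + 1) * rowSeries n = (H : PowerSeries ℤ) ∧
      H.degree = ((n - 2 : ℕ) : WithBot ℕ) ∧
      H = ∑ j ∈ Finset.range (n - 1),
        Polynomial.C (arrayM (n - 2 - j) j) * Polynomial.X ^ j) ∧
    (∀ i j : Fin 6, arrayM i j = tableM i j) ∧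
    (∀ n k : ℕ, arrayM n k = arrayM k n) ∧
    (∀ n : ℕ, 2 ≤ n →
      rowSeries n = magicSeries (loopedPath n) ∧
      ∃ F : RatFunc ℚ, IsExpansionOf (magicSeries (loopedPath n)) F ∧
        RatFunc.X ^ 3 * F = (-1) ^ (n + 1) * invertVar F) := by
  refine ⟨fun n hn => ⟨numPoly n, one_sub_X_pow_mul_rowSeries hn, degree_numPoly hn, rfl⟩,
    arrayM_eq_tableM, arrayM_symm, fun n hn => ⟨rowSeries_eq_magicSeries n, rowRatFunc n, ?_,
      rowRatFunc_reciprocity hn⟩⟩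
  rw [← rowSeries_eq_magicSeries]
  exact isExpansionOf_rowRatFunc hn
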